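/- Let $b,d,D\ge 2$ and $n\ge 1$ be integers such that $d$ and $D$ are incommensurable, i.e. $\log_d D$ is irrational, and such that $d>2$ or $n>1$. A best $n$-digit radix-$d$ approximation of a real $r>0$ is a number $m\,d^q$ with integers $m,q$, $d^{n-1}\le m<d^n$, such that $r=(m+\varepsilon)d^q$ with $|\varepsilon|\le 1/2$, and with $\varepsilon\ge -1/(2d)$ in case $m=d^{n-1}$; the integer $m$ is its significand (it is unique except for ties). For every $e\in\mathbb N$ let $s(e)$ be the significand of the best $n$-digit radix-$d$ approximation of $D^e$, where ties are broken in an arbitrary fixed way. For $c\in\{0,\dots,d-1\}$ let $L_c$ (respectively $M_c$) be the language of all finite strings $z$ over the alphabet $\{0,\dots,b-1\}$ such that, when $e$ is the number with radix-$b$ digit string $z$ read least significant digit first (respectively most significant digit first), the $n$-digit radix-$d$ numeral of $s(e)$ starts with the digit $c$ if $d>2$, and with the two digits $1c$ if $d=2$. Then there are digits $d_1,d_2<d$ such that neither $L_{d_1}$ nor $M_{d_2}$ is context-free. Moreover, no push-down automaton computes the significand of the best $n$-digit radix-$d$ approximation of $D^e$ from the radix-$b$ digits of $e$, in either reading order.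 Here a (possibly nondeterministic) push-down automaton reads the digit string followed by a stop marker, and it computes a function $f$ if its final states can be labelled by outputs in such a way that on every input string $z$ at least one computation consumes the whole input and ends in a final state, and every final state in which such a computation ends is labelled $f(z)$; the claim is that there is no such computable $f$ for which $f(z)$ is, for every $z$, the significand of a best approximation of $D^e$, where $e$ is the value of $z$. -/

import Mathlib

/-- `m` is the significand of a best `n`-digit radix-`d` floating point approximation of `r`:
`r = (m + ε) d^q` with `d^(n-1) ≤ m < d^n`, `|ε| ≤ 1/2`, and `m = d^(n-1)` only if
`-1/(2d) ≤ ε`. It is unique except when `r` is equally far from two consecutive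
floating point numbers. -/
def IsBestSignificand (d n : ℕ) (r : ℝ) (m : ℕ) : Prop :=
  d ^ (n - 1) ≤ m ∧ m < d ^ n ∧
    ∃ (q : ℤ) (ε : ℝ), r = ((m : ℝ) + ε) * (d : ℝ) ^ q ∧ |ε| ≤ 1 / 2 ∧
      (m = d ^ (n - 1) → -1 / (2 * (d : ℝ)) ≤ ε)

/-- Every positive real has a best `n`-digit approximation. -/
theorem exists_isBestSignificand (d n : ℕ) (hd : 2 ≤ d) (hn : 1 ≤ n) (r : ℝ) (hr : 0 < r) :
    ∃ m, IsBestSignificand d n r m := by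
  obtain ⟨k, rfl⟩ : ∃ k, n = k + 1 := ⟨n - 1, by omega⟩
  have hd0 : (0 : ℝ) < d := by positivity
  have hd2 : (2 : ℝ) ≤ d := by exact_mod_cast hd
  set l := Int.log d r with hl
  have h1 : (d : ℝ) ^ l ≤ r := Int.zpow_log_le_self (by omega) hr
  have h2 : r < (d : ℝ) ^ (l + 1) := Int.lt_zpow_succ_log_self (by omega) r
  have hp : (0 : ℝ) < (d : ℝ) ^ (l - k) := by positivity
  set x := r / (d : ℝ) ^ (l - k) with hx
  have hrx : r = x * (d : ℝ) ^ (l - k) := by rw [hx]; field_simp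
  have hx1 : (d : ℝ) ^ k ≤ x := by
    rw [hx, le_div_iff₀ hp, ← zpow_natCast, ← zpow_add₀ hd0.ne']
    simpa using h1
  have hx2 : x < (d : ℝ) ^ (k + 1) := by
    rw [hx, div_lt_iff₀ hp, ← zpow_natCast, ← zpow_add₀ hd0.ne']
    have he : ((k + 1 : ℕ) : ℤ) + (l - k) = l + 1 := by push_cast; ring
    rw [he]
    exact h2
  have hx0 : 0 ≤ x := le_trans (by positivity) hx1
  have hf := Nat.floor_le hx0
  have hf' := Nat.lt_floor_add_one x
  have hfl : d ^ k ≤ ⌊x⌋₊ := Nat.le_floor (by exact_mod_cast hx1)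
  have hfu : ⌊x⌋₊ < d ^ (k + 1) := (Nat.floor_lt hx0).2 (by exact_mod_cast hx2)
  by_cases hc : x - ⌊x⌋₊ ≤ 1 / 2
  · refine ⟨⌊x⌋₊, by simpa using hfl, hfu, l - k, x - ⌊x⌋₊, by rw [add_sub_cancel]; exact hrx,
      by rw [abs_le]; constructor <;> linarith, fun _ => ?_⟩
    have : -1 / (2 * (d : ℝ)) ≤ 0 := div_nonpos_of_nonpos_of_nonneg (by norm_num) (by positivity)
    linarith
  · push Not at hc
    rcases Nat.lt_or_ge (⌊x⌋₊ + 1) (d ^ (k + 1)) with h | h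
    · refine ⟨⌊x⌋₊ + 1, by simp; omega, h, l - k, x - (⌊x⌋₊ + 1), ?_, ?_, fun h' => ?_⟩
      · push_cast; rw [add_sub_cancel]; exact hrx
      · rw [abs_le]; constructor <;> linarith
      · simp at h'; omega
    · have he : (⌊x⌋₊ : ℝ) + 1 = (d : ℝ) ^ (k + 1) := by
        exact_mod_cast le_antisymm (Nat.succ_le_of_lt hfu) h
      refine ⟨d ^ k, by simp, Nat.pow_lt_pow_right (by omega) (by omega), l - k + 1,
        (x - (d : ℝ) ^ (k + 1)) / d, ?_, ?_, fun _ => ?_⟩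
      · rw [zpow_add_one₀ hd0.ne', hrx]
        push_cast
        field_simp
        ring
      · rw [abs_div, abs_of_pos hd0, div_le_iff₀ hd0, abs_le]
        constructor <;> linarith
      · rw [div_le_div_iff₀ (by positivity) hd0]
        nlinarith

/-- Value of a string of radix-`b` digits whose leftmost digit is the least significant. -/
def valueLSD (b : ℕ) (z : List (Fin b)) : ℕ := Nat.ofDigits b (z.map Fin.val)

/-- Value of a string of radix-`b` digits whose leftmost digit is the most significant. -/
def valueMSD (b : ℕ) (z : List (Fin b)) : ℕ := Nat.ofDigits b (z.reverse.map Fin.val)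

/-- The `n`-digit radix-`d` numeral of `m` starts with the digit `c` if `d ≠ 2`, and with
the two digits `1c` if `d = 2`. -/
def LeadsWith (d n m c : ℕ) : Prop :=
  if d = 2 then m / 2 ^ (n - 2) = 2 + c else m / d ^ (n - 1) = c

/-- `s e` is, for every `e`, the significand of a best approximation of `D ^ e`
(ties may be broken in any way). -/
def IsSignificandSeq (d n D : ℕ) (s : ℕ → ℕ) : Prop :=
  ∀ e : ℕ, IsBestSignificand d n ((D : ℝ) ^ e) (s e)

/-- Strings, read least significant digit first, of exponents `e` for which `s e` starts
with `c`. -/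
def langL (b d n : ℕ) (s : ℕ → ℕ) (c : ℕ) : Language (Fin b) :=
  {z | LeadsWith d n (s (valueLSD b z)) c}

/-- Strings, read most significant digit first, of exponents `e` for which `s e` starts
with `c`. -/
def langM (b d n : ℕ) (s : ℕ → ℕ) (c : ℕ) : Language (Fin b) :=
  {z | LeadsWith d n (s (valueMSD b z)) c}

/-- A (nondeterministic) push-down automaton with states `Q`, input alphabet `T` and stack
alphabet `Γ`. A pair `(p, α) ∈ δ q a X` means: in state `q` with `X` on top of the stack,
reading `a` (or nothing, if `a = none`), go to `p` and replace `X` by the word `α`. -/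
structure PushdownAutomaton (Q T Γ : Type) where
  start : Q
  bottom : Γ
  final : Set Q
  δ : Q → Option T → Γ → Finset (Q × List Γ)

namespace PushdownAutomaton

variable {Q T Γ : Type}

/-- One move between configurations (state, remaining input, stack with its top first). -/
inductive Step (M : PushdownAutomaton Q T Γ) :
    Q × List T × List Γ → Q × List T × List Γ → Prop
  | read {q p : Q} {a : T} {X : Γ} {α : List Γ} (w : List T) (β : List Γ)
      (h : (p, α) ∈ M.δ q (some a) X) : Step M (q, a :: w, X :: β) (p, w, α ++ β)
  | eps {q p : Q} {X : Γ} {α : List Γ} (w : List T) (β : List Γ)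
      (h : (p, α) ∈ M.δ q none X) : Step M (q, w, X :: β) (p, w, α ++ β)

/-- Some computation on the input `w` consumes all of `w` and ends in the final state `q`. -/
def EndsIn (M : PushdownAutomaton Q T Γ) (w : List T) (q : Q) : Prop :=
  q ∈ M.final ∧ ∃ γ, Relation.ReflTransGen M.Step (M.start, w, [M.bottom]) (q, [], γ)

/-- `M`, whose input is a word followed by the stop marker `none`, computes `f` by decoding
its final state with `out`: on every word some computation ends in a final state, and every
final state in which a computation ends is decoded to the value of `f`. -/
def Computes {A O : Type} (M : PushdownAutomaton Q (Option A) Γ) (out : Q → O)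
    (f : List A → O) : Prop :=
  ∀ z : List A, (∃ q, M.EndsIn (z.map some ++ [none]) q) ∧
    ∀ q, M.EndsIn (z.map some ++ [none]) q → out q = f z

end PushdownAutomaton

/-- Some push-down automaton (finitely many states and stack symbols) computes `f`. -/
def PDAComputable {A O : Type} (f : List A → O) : Prop :=
  ∃ (Q Γ : Type) (_ : Finite Q) (_ : Finite Γ) (M : PushdownAutomaton Q (Option A) Γ)
    (out : Q → O), M.Computes out f

/-! Write θ for the logarithm of D to base d. The exponents e whose significand lies below a
threshold B, with d^(n-1) < B < d^n, are those for which eθ lies, modulo one, in a proper arc; ties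
occur only at its endpoints. For d > 2 the leading digit 1 gives such a threshold; for d = 2 the
second digit 0 does. It therefore suffices to show that neither a context-free language nor a
push-down computation can decide membership in this arc.

The automata side is `HasExponentPumping`: in words p aᴷ s, every large exponent K may be replaced
by K + Q with one fixed Q > 0. A derivation is annotated with the states of a finite automaton for p
a* s. If no annotated nonterminal in it admits a nonempty pumping context, its word has bounded
length; otherwise iterating such a context adds exactly Q letters, Q being a common multiple of the
finitely many context lengths, and the new word still has the form p aᴷ s. This uses only finitely
many left-hand sides and bounded right-hand sides, so it covers both grammars and the triple
construction for push-down automata.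

On the arithmetic side, a numeral of k followed by zeros and a final digit 1, least significant
digit first, represents k + bᴷ. Pumping makes "(k + bᴷ)θ is in the arc" eventually periodic in K for
each k. As θ is irrational, finitely many shifts kθ separate any two points of the circle at
distance at least 1/(2b). With a common period R for these k, bᴷθ and bᴷ⁺ᴿθ would have to be closer
than that for all large K. But their difference is bᴷφ modulo one with φ = (bᴿ - 1)θ irrational, and
a small nonzero distance to the integers is multiplied by b at each step until it exceeds 1/(2b). -/

/-! ### Words derived by context-free rules, and the states of a finite automaton -/

section Derivations

variable {T N σ : Type*}

/-- `DerivesWord R s w`: the sentential form `s` derives the terminal word `w` by the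
context-free rules `A → o`, `R A o`. -/
inductive DerivesWord (R : N → List (Symbol T N) → Prop) : List (Symbol T N) → List T → Prop
  | nil : DerivesWord R [] []
  | terminal (a : T) {s : List (Symbol T N)} {w : List T} (h : DerivesWord R s w) :
      DerivesWord R (.terminal a :: s) (a :: w)
  | nonterminal {A : N} {o s : List (Symbol T N)} {w₁ w₂ : List T} (hR : R A o)
      (h₁ : DerivesWord R o w₁) (h₂ : DerivesWord R s w₂) :
      DerivesWord R (.nonterminal A :: s) (w₁ ++ w₂)

/-- Derivations of a word that is read by the automaton `M` from the state `q`, in which every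
nonterminal `A`, together with the states in which `M` enters and leaves the factor that `A`
derives, forms a triple in `W`. -/
inductive DerivesWithin (R : N → List (Symbol T N) → Prop) (M : DFA T σ) (W : Set (σ × N × σ)) :
    σ → List (Symbol T N) → List T → Prop
  | nil (q : σ) : DerivesWithin R M W q [] []
  | terminal (q : σ) (a : T) {s : List (Symbol T N)} {w : List T}
      (h : DerivesWithin R M W (M.step q a) s w) : DerivesWithin R M W q (.terminal a :: s) (a :: w)
  | nonterminal (q : σ) {A : N} {o s : List (Symbol T N)} {w₁ w₂ : List T} (hR : R A o)
      (hW : (q, A, M.evalFrom q w₁) ∈ W) (h₁ : DerivesWithin R M W q o w₁)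
      (h₂ : DerivesWithin R M W (M.evalFrom q w₁) s w₂) :
      DerivesWithin R M W q (.nonterminal A :: s) (w₁ ++ w₂)

/-- `(v, x)` is a context that may be put around the factor derived by a nonterminal `A`
between the states `p` and `q`, where `X = (p, A, q)`. -/
def IsLoop (R : N → List (Symbol T N) → Prop) (M : DFA T σ) (X : σ × N × σ) (v x : List T) :
    Prop :=
  M.evalFrom X.1 v = X.1 ∧ M.evalFrom X.2.2 x = X.2.2 ∧
    ∀ w, DerivesWord R [.nonterminal X.2.1] w → DerivesWord R [.nonterminal X.2.1] (v ++ w ++ x)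

variable {R : N → List (Symbol T N) → Prop} {M : DFA T σ} {W : Set (σ × N × σ)}

theorem DerivesWord.append {s₁ s₂ : List (Symbol T N)} {w₁ w₂ : List T}
    (h₁ : DerivesWord R s₁ w₁) (h₂ : DerivesWord R s₂ w₂) :
    DerivesWord R (s₁ ++ s₂) (w₁ ++ w₂) := by
  induction h₁ with
  | nil => exact h₂
  | terminal a _ ih => exact .terminal a ih
  | nonterminal hR h _ _ ih => rw [List.append_assoc]; exact .nonterminal hR h ih

theorem DerivesWord.exists_of_append {s₁ s₂ : List (Symbol T N)} {w : List T}
    (h : DerivesWord R (s₁ ++ s₂) w) :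
    ∃ w₁ w₂, w = w₁ ++ w₂ ∧ DerivesWord R s₁ w₁ ∧ DerivesWord R s₂ w₂ := by
  induction s₁ generalizing w with
  | nil => exact ⟨[], w, rfl, .nil, h⟩
  | cons x s ih =>
    cases h with
    | terminal a h =>
      obtain ⟨w₁, w₂, rfl, h₁, h₂⟩ := ih h
      exact ⟨a :: w₁, w₂, rfl, .terminal a h₁, h₂⟩
    | nonterminal hR h h' =>
      obtain ⟨w₁, w₂, rfl, h₁, h₂⟩ := ih h'
      exact ⟨_, w₂, (List.append_assoc ..).symm, .nonterminal hR h h₁, h₂⟩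

theorem DerivesWord.of_rule {A : N} {o : List (Symbol T N)} {w : List T} (hR : R A o)
    (h : DerivesWord R o w) : DerivesWord R [.nonterminal A] w := by
  simpa using DerivesWord.nonterminal hR h .nil

theorem DerivesWord.cons_of_single {A : N} {s : List (Symbol T N)} {w₁ w₂ : List T}
    (h₁ : DerivesWord R [.nonterminal A] w₁) (h₂ : DerivesWord R s w₂) :
    DerivesWord R (.nonterminal A :: s) (w₁ ++ w₂) :=
  h₁.append h₂

theorem DerivesWithin.derivesWord {q : σ} {s : List (Symbol T N)} {w : List T}
    (h : DerivesWithin R M W q s w) : DerivesWord R s w := by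
  induction h with
  | nil q => exact .nil
  | terminal q a _ ih => exact .terminal a ih
  | nonterminal q hR _ _ _ ih₁ ih₂ => exact .nonterminal hR ih₁ ih₂

theorem IsLoop.iterate {X : σ × N × σ} {v x : List T} (h : IsLoop R M X v x) (i : ℕ) :
    ∃ v' x' : List T, IsLoop R M X v' x' ∧
      v'.length + x'.length = i * (v.length + x.length) := by
  induction i with
  | zero => exact ⟨[], [], ⟨rfl, rfl, fun w hw => by simpa using hw⟩, by simp⟩
  | succ i ih =>
    obtain ⟨v', x', ⟨h₁, h₂, h₃⟩, hl⟩ := ih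
    refine ⟨v ++ v', x' ++ x, ⟨?_, ?_, fun w hw => ?_⟩, ?_⟩
    · rw [DFA.evalFrom_of_append, h.1, h₁]
    · rw [DFA.evalFrom_of_append, h₂, h.2.1]
    · simpa [List.append_assoc] using h.2.2 _ (h₃ w hw)
    · simp only [List.length_append]; linarith

/-- A derivation either avoids all triples with a nontrivial loop, or can be pumped by `Q`. -/
theorem DerivesWord.within_or_pump {Q : ℕ}
    (hQ : ∀ X ∉ W, X.2.1 ∈ {A | ∃ o, R A o} →
      ∃ v x, IsLoop R M X v x ∧ v.length + x.length = Q)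
    {s : List (Symbol T N)} {w : List T} (h : DerivesWord R s w) (q : σ) :
    DerivesWithin R M W q s w ∨ ∃ w', DerivesWord R s w' ∧ M.evalFrom q w' = M.evalFrom q w ∧
      w'.length = w.length + Q := by
  induction h generalizing q with
  | nil => exact .inl (.nil q)
  | @terminal a s w h ih =>
    rcases ih (M.step q a) with h | ⟨w', h, he, hl⟩
    · exact .inl (.terminal q a h)
    · exact .inr ⟨a :: w', .terminal a h, he, by simp [hl]; ring⟩
  | @nonterminal A o s w₁ w₂ hR h₁ h₂ ih₁ ih₂ =>
    by_cases hW : (q, A, M.evalFrom q w₁) ∈ W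
    · rcases ih₁ q with h₁' | ⟨w', h, he, hl⟩
      · rcases ih₂ (M.evalFrom q w₁) with h₂' | ⟨w', h, he, hl⟩
        · exact .inl (.nonterminal q hR hW h₁' h₂')
        · refine .inr ⟨w₁ ++ w', .nonterminal hR h₁ h, ?_, by simp [hl]; ring⟩
          simp only [DFA.evalFrom_of_append, he]
      · refine .inr ⟨w' ++ w₂, .nonterminal hR h h₂, ?_, by simp [hl]; ring⟩
        simp only [DFA.evalFrom_of_append, he]
    · obtain ⟨v, x, ⟨hv, hx, hl⟩, hlen⟩ := hQ _ hW ⟨o, hR⟩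
      dsimp only at hv hx hl
      refine .inr ⟨(v ++ w₁ ++ x) ++ w₂, (hl w₁ (.of_rule hR h₁)).cons_of_single h₂, ?_, ?_⟩
      · simp only [DFA.evalFrom_of_append, hv, hx]
      · simp only [List.length_append]; omega

/-- A derivation either avoids the triple `X`, or contains a factor derived by `X` below which
`X` does not occur. -/
theorem DerivesWithin.avoid_or_factor (X : σ × N × σ) {q : σ} {s : List (Symbol T N)}
    {w : List T} (h : DerivesWithin R M W q s w) :
    DerivesWithin R M (W \ {X}) q s w ∨ ∃ u w' y o, w = u ++ w' ++ y ∧ M.evalFrom q u = X.1 ∧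
      M.evalFrom X.1 w' = X.2.2 ∧ R X.2.1 o ∧ DerivesWithin R M (W \ {X}) X.1 o w' ∧
      ∀ w'', DerivesWord R [.nonterminal X.2.1] w'' → DerivesWord R s (u ++ w'' ++ y) := by
  induction h with
  | nil q => exact .inl (.nil q)
  | terminal q a h ih =>
    rcases ih with h | ⟨u, w', y, o, rfl, hu, hw', hR, hD, hs⟩
    · exact .inl (.terminal q a h)
    · exact .inr ⟨a :: u, w', y, o, by simp, hu, hw', hR, hD, fun w'' hw => .terminal a (hs w'' hw)⟩
  | @nonterminal q A o s w₁ w₂ hR hW h₁ h₂ ih₁ ih₂ =>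
    rcases ih₁ with h₁' | ⟨u, w', y, o', rfl, hu, hw', hR', hD, hs⟩
    · by_cases hX : (q, A, M.evalFrom q w₁) = X
      -- No occurrence of the triple lies below the root, so the root is itself an innermost
      -- occurrence.
      · subst hX
        exact .inr ⟨[], w₁, w₂, o, by simp, rfl, rfl, hR, h₁',
          fun w'' hw => hw.cons_of_single h₂.derivesWord⟩
      · rcases ih₂ with h₂' | ⟨u, w', y, o', rfl, hu, hw', hR', hD, hs⟩
        · exact .inl (.nonterminal q hR ⟨hW, hX⟩ h₁' h₂')
        · refine .inr ⟨w₁ ++ u, w', y, o', by simp, ?_, hw', hR', hD, fun w'' hw => ?_⟩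
          · rw [DFA.evalFrom_of_append, hu]
          · simpa [List.append_assoc] using
              DerivesWord.nonterminal hR h₁.derivesWord (hs w'' hw)
    · refine .inr ⟨u, w', y ++ w₂, o', by simp, hu, hw', hR', hD, fun w'' hw => ?_⟩
      simpa [List.append_assoc] using DerivesWord.nonterminal hR (hs w'' hw) h₂.derivesWord

/-- If no triple of the finite set `W` has a nontrivial loop, then the words derived within `W`
have bounded length. -/
theorem exists_length_le_of_derivesWithin {m : ℕ} (hm : ∀ A o, R A o → o.length ≤ m) (n : ℕ) :
    ∀ W : Set (σ × N × σ), W.Finite → W.ncard = n →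
      (∀ X ∈ W, ∀ v x, IsLoop R M X v x → v.length + x.length = 0) →
      ∃ B, ∀ q s w, DerivesWithin R M W q s w → w.length ≤ B * s.length := by
  induction n with
  | zero =>
    intro W hW hc _
    obtain rfl : W = ∅ := (Set.ncard_eq_zero hW).1 hc
    refine ⟨1, fun q s w h => ?_⟩
    induction h with
    | nil q => simp
    | terminal q a _ ih => simp at ih ⊢; omega
    | nonterminal q hR hW => exact hW.elim
  | succ n ih =>
    intro W hW hc hbad
    have hex : ∀ X : σ × N × σ, ∃ B, X ∈ W →
        ∀ q s w, DerivesWithin R M (W \ {X}) q s w → w.length ≤ B * s.length := by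
      intro X
      by_cases hX : X ∈ W
      · obtain ⟨B, hB⟩ := ih (W \ {X}) hW.sdiff
          (by rw [Set.ncard_sdiff_singleton_of_mem hX, hc]; rfl) (fun Y hY => hbad Y hY.1)
        exact ⟨B, fun _ => hB⟩
      · exact ⟨0, fun h => (hX h).elim⟩
    choose B hB using hex
    obtain ⟨C, hC⟩ := (hW.image B).bddAbove
    refine ⟨C * m + 1, fun q s w h => ?_⟩
    induction h with
    | nil q => simp
    | terminal q a _ ih => simp only [List.length_cons]; linarith [Nat.zero_le (C * m)]
    | @nonterminal q A o s w₁ w₂ hR hX h₁ h₂ _ ih₂ =>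
      have key : ∀ o' w', R A o' → DerivesWithin R M (W \ {(q, A, M.evalFrom q w₁)}) q o' w' →
          w'.length ≤ C * m := fun o' w' hR' hD =>
        (hB _ hX q o' w' hD).trans (Nat.mul_le_mul (hC ⟨_, hX, rfl⟩) (hm _ _ hR'))
      have h₁' : w₁.length ≤ C * m := by
        -- At an innermost occurrence of the same triple the surrounding context is a loop, hence
        -- empty by hypothesis; `w₁` is then as short as a word derived without that triple.
        rcases h₁.avoid_or_factor (q, A, M.evalFrom q w₁) with
          hD | ⟨u, w', y, o', hw, hu, hw', hR', hD, hs⟩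
        · exact key o w₁ hR hD
        · have hl : IsLoop R M (q, A, M.evalFrom q w₁) u y := by
            refine ⟨hu, ?_, fun w'' hw'' => .of_rule hR (hs w'' hw'')⟩
            dsimp only at hu hw' ⊢
            nth_rewrite 2 [hw]
            rw [DFA.evalFrom_of_append, DFA.evalFrom_of_append, hu, hw']
          have h0 := hbad _ hX u y hl
          have h1 := key o' w' hR' hD
          rw [hw]
          simp only [List.length_append]
          omega
      simp only [List.length_append, List.length_cons]
      linarith

/-- Pumping for context-free derivations that preserves the state reached by a finite automaton:
the lengths of long words may be increased by a fixed amount. -/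
theorem exists_pump_of_derivesWord [Finite σ] (M : DFA T σ) (hfin : {A | ∃ o, R A o}.Finite)
    {m : ℕ} (hm : ∀ A o, R A o → o.length ≤ m) :
    ∃ Q > 0, ∃ B, ∀ A w, B < w.length → DerivesWord R [.nonterminal A] w →
      ∃ w', DerivesWord R [.nonterminal A] w' ∧ M.eval w' = M.eval w ∧
        w'.length = w.length + Q := by
  classical
  let V : Set (σ × N × σ) := Set.univ ×ˢ ({A | ∃ o, R A o} ×ˢ Set.univ)
  have hV : V.Finite := Set.finite_univ.prod (hfin.prod Set.finite_univ)
  let G : Set (σ × N × σ) := {X ∈ V | ∃ v x, IsLoop R M X v x ∧ 0 < v.length + x.length}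
  have hG : G.Finite := hV.subset (Set.sep_subset _ _)
  have hk : ∀ X : σ × N × σ, ∃ k > 0, X ∈ G →
      ∃ v x, IsLoop R M X v x ∧ v.length + x.length = k := by
    intro X
    by_cases hX : X ∈ G
    · obtain ⟨v, x, h, h0⟩ := hX.2
      exact ⟨_, h0, fun _ => ⟨v, x, h, rfl⟩⟩
    · exact ⟨1, one_pos, fun h => (hX h).elim⟩
  choose k hk0 hk using hk
  obtain ⟨B, hB⟩ := exists_length_le_of_derivesWithin (M := M) hm _ (V \ G) hV.sdiff rfl (by
    intro X hX v x h
    by_contra h0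
    exact hX.2 ⟨hX.1, v, x, h, Nat.pos_of_ne_zero h0⟩)
  -- The product is a multiple of every chosen loop length, so each loop can be iterated to total
  -- length exactly `Q`.
  refine ⟨∏ X ∈ hG.toFinset, k X, Finset.prod_pos fun X _ => hk0 X, B, fun A w hw h => ?_⟩
  have hor := h.within_or_pump (M := M) (W := (V \ G)) (Q := ∏ X ∈ hG.toFinset, k X) (by
    intro X hX hR
    have hXG : X ∈ G := by
      by_contra hn
      exact hX ⟨⟨trivial, hR, trivial⟩, hn⟩
    obtain ⟨v, x, hl, he⟩ := hk X hXG
    obtain ⟨c, hc⟩ := Finset.dvd_prod_of_mem k (hG.mem_toFinset.2 hXG)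
    obtain ⟨v', x', hl', he'⟩ := hl.iterate c
    exact ⟨v', x', hl', by rw [he', he, hc, mul_comm]⟩) M.start
  rcases hor with h' | h'
  · have := hB _ _ _ h'
    simp at this
    omega
  · exact h'

end Derivations

/-! ### Words of the form `p aᴺ s` -/

section Pattern

variable {T : Type*}

/-- An automaton for the words `p aᴺ s`. -/
def repeatNFA (p : List T) (a : T) (s : List T) : NFA T (Fin (p.length + s.length + 1)) where
  step i c := {j | (i.val = p.length ∧ j = i ∧ c = a) ∨
    (j.val = i.val + 1 ∧ (p ++ s)[i.val]? = some c)}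
  start := {0}
  accept := {Fin.last _}

/-- The state counts the letters of `p ++ s` read so far, and the loop on `a` exists only at
`p.length`; before that, the truncated difference makes the part of `s` empty. -/
theorem eq_of_mem_eval_repeatNFA (p : List T) (a : T) (s w : List T)
    {j : Fin (p.length + s.length + 1)} (hj : j ∈ (repeatNFA p a s).eval w) :
    ∃ k, w = p.take j ++ List.replicate k a ++ s.take (j - p.length) ∧
      (j.val < p.length → k = 0) := by
  induction w using List.reverseRecOn generalizing j with
  | nil =>
    obtain rfl : j = 0 := hj
    exact ⟨0, by simp, fun _ => rfl⟩
  | append_singleton w c ih =>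
    rw [NFA.eval_append_singleton, NFA.mem_stepSet] at hj
    obtain ⟨i, hi, hij⟩ := hj
    obtain ⟨k, rfl, hk⟩ := ih hi
    rcases hij with ⟨h₁, rfl, rfl⟩ | ⟨h₁, h₂⟩
    · refine ⟨k + 1, ?_, fun h => by omega⟩
      simp [h₁, List.replicate_succ']
    · rw [h₁]
      rcases lt_or_ge i.val p.length with h | h
      · rw [List.getElem?_append_left h] at h₂
        refine ⟨0, ?_, fun _ => rfl⟩
        rw [hk h, Nat.sub_eq_zero_of_le h.le, Nat.sub_eq_zero_of_le (by omega),
          List.take_add_one, h₂]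
        simp
      · rw [List.getElem?_append_right h] at h₂
        refine ⟨k, ?_, fun h' => by omega⟩
        rw [Nat.sub_add_comm h, List.take_add_one (l := s), h₂, List.take_of_length_le h,
          List.take_of_length_le (by omega : p.length ≤ i.val + 1)]
        simp

theorem mem_evalFrom_repeatNFA (p : List T) (a : T) (s : List T) {i j : ℕ} (l : List T)
    (hij : i + l.length = j) (hj : j < p.length + s.length + 1)
    (hl : ∀ k, k < l.length → (p ++ s)[i + k]? = l[k]?) (S : Set (Fin (p.length + s.length + 1)))
    (hS : (⟨i, by omega⟩ : Fin (p.length + s.length + 1)) ∈ S) :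
    (⟨j, hj⟩ : Fin (p.length + s.length + 1)) ∈ (repeatNFA p a s).evalFrom S l := by
  induction l generalizing i S with
  | nil => subst hij; exact hS
  | cons c l ih =>
    rw [NFA.evalFrom_cons]
    simp only [List.length_cons] at hij hl
    refine ih (i := i + 1) (by omega) (fun k hk => ?_) _ ?_
    · rw [show i + 1 + k = i + (k + 1) by ring]
      simpa using hl (k + 1) (by omega)
    · rw [NFA.mem_stepSet]
      exact ⟨_, hS, .inr ⟨rfl, by simpa using hl 0 (by omega)⟩⟩

theorem mem_evalFrom_repeatNFA_replicate (p : List T) (a : T) (s : List T) (k : ℕ)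
    (S : Set (Fin (p.length + s.length + 1)))
    (hS : (⟨p.length, by omega⟩ : Fin (p.length + s.length + 1)) ∈ S) :
    (⟨p.length, by omega⟩ : Fin (p.length + s.length + 1)) ∈
      (repeatNFA p a s).evalFrom S (List.replicate k a) := by
  induction k generalizing S with
  | zero => exact hS
  | succ k ih =>
    rw [List.replicate_succ, NFA.evalFrom_cons]
    refine ih _ ?_
    rw [NFA.mem_stepSet]
    exact ⟨_, hS, .inl ⟨rfl, rfl, rfl⟩⟩

theorem mem_accepts_repeatNFA (p : List T) (a : T) (s w : List T) :
    w ∈ (repeatNFA p a s).accepts ↔ ∃ k, w = p ++ List.replicate k a ++ s := by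
  constructor
  · rintro ⟨j, hj, hw⟩
    obtain rfl : j = Fin.last _ := hj
    obtain ⟨k, hk, -⟩ := eq_of_mem_eval_repeatNFA p a s w hw
    refine ⟨k, hk.trans ?_⟩
    simp [List.take_of_length_le]
  · rintro ⟨k, rfl⟩
    rw [NFA.mem_accepts]
    refine ⟨Fin.last _, rfl, ?_⟩
    rw [NFA.evalFrom_append, NFA.evalFrom_append]
    refine mem_evalFrom_repeatNFA p a s (i := p.length) s rfl (by omega) (fun k hk => ?_) _ ?_
    · rw [List.getElem?_append_right (by omega), Nat.add_sub_cancel_left]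
    · refine mem_evalFrom_repeatNFA_replicate p a s k _ ?_
      refine mem_evalFrom_repeatNFA p a s p (i := 0) (by omega) (by omega) (fun k hk => ?_) _ rfl
      simp [List.getElem?_append_left hk]

variable {N : Type*} {R : N → List (Symbol T N) → Prop}

/-- For the words `p aᴷ s` derived by context-free rules, large exponents `K` may be increased by
a fixed amount. -/
theorem exists_pump_replicate (hfin : {A | ∃ o, R A o}.Finite)
    {m : ℕ} (hm : ∀ A o, R A o → o.length ≤ m) (p : List T) (a : T) (s : List T) :
    ∃ Q > 0, ∃ B, ∀ A, ∀ K > B,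
      DerivesWord R [.nonterminal A] (p ++ List.replicate K a ++ s) →
      DerivesWord R [.nonterminal A] (p ++ List.replicate (K + Q) a ++ s) := by
  obtain ⟨Q, hQ, B, h⟩ := exists_pump_of_derivesWord (repeatNFA p a s).toDFA hfin hm
  refine ⟨Q, hQ, B, fun A K hK hw => ?_⟩
  obtain ⟨w', hw', he, hl⟩ := h A _ (by simp; omega) hw
  have hacc : w' ∈ (repeatNFA p a s).toDFA.accepts := by
    have h1 : p ++ List.replicate K a ++ s ∈ (repeatNFA p a s).toDFA.accepts := by
      rw [NFA.toDFA_correct, mem_accepts_repeatNFA]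
      exact ⟨K, rfl⟩
    rw [DFA.mem_accepts] at h1 ⊢
    rwa [he]
  rw [NFA.toDFA_correct, mem_accepts_repeatNFA] at hacc
  obtain ⟨k, rfl⟩ := hacc
  -- Among the words p aᵏ s the length determines the exponent.
  obtain rfl : k = K + Q := by simp at hl; omega
  exact hw'

end Pattern

/-! ### Context-free languages and push-down automata -/

/-- For every pattern `p aᴷ s`, large exponents `K` of words of `L` may be increased by a fixed
amount. -/
def HasExponentPumping {T : Type*} (L : Set (List T)) : Prop :=
  ∀ (p : List T) (a : T) (s : List T), ∃ Q > 0, ∃ B, ∀ K > B,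
    p ++ List.replicate K a ++ s ∈ L → p ++ List.replicate (K + Q) a ++ s ∈ L

namespace ContextFreeGrammar

variable {T : Type*} (g : ContextFreeGrammar T)

/-- The rules of a grammar as a relation. -/
def RuleRel (A : g.NT) (o : List (Symbol T g.NT)) : Prop :=
  ∃ r ∈ g.rules, r.input = A ∧ r.output = o

theorem derivesWord_map_terminal (w : List T) :
    DerivesWord g.RuleRel (w.map Symbol.terminal) w := by
  induction w with
  | nil => exact .nil
  | cons a w ih => exact .terminal a ih

theorem derivesWord_of_derives {s : List (Symbol T g.NT)} {w : List T}
    (h : g.Derives s (w.map Symbol.terminal)) : DerivesWord g.RuleRel s w := by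
  induction h using Relation.ReflTransGen.head_induction_on with
  | refl => exact g.derivesWord_map_terminal w
  | head h _ ih =>
    obtain ⟨r, hr, h⟩ := h
    obtain ⟨p, q, rfl, rfl⟩ := h.exists_parts
    obtain ⟨w', w₃, rfl, h', h₃⟩ := ih.exists_of_append
    obtain ⟨w₁, w₂, rfl, h₁, h₂⟩ := h'.exists_of_append
    exact (h₁.append (.of_rule ⟨r, hr, rfl, rfl⟩ h₂)).append h₃

theorem derives_of_derivesWord {s : List (Symbol T g.NT)} {w : List T}
    (h : DerivesWord g.RuleRel s w) : g.Derives s (w.map Symbol.terminal) := by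
  induction h with
  | nil => exact .refl _
  | terminal a _ ih => exact ih.append_left [.terminal a]
  | @nonterminal A o s w₁ w₂ hR _ _ ih₁ ih₂ =>
    obtain ⟨r, hr, rfl, rfl⟩ := hR
    rw [List.map_append]
    have h : g.Produces (.nonterminal r.input :: s) (r.output ++ s) := ⟨r, hr, .head s⟩
    exact h.trans_derives ((ih₁.append_right s).trans (ih₂.append_left _))

theorem mem_language_iff_derivesWord (w : List T) :
    w ∈ g.language ↔ DerivesWord g.RuleRel [.nonterminal g.initial] w :=
  ⟨fun h => g.derivesWord_of_derives h, fun h => g.derives_of_derivesWord h⟩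

end ContextFreeGrammar

theorem Language.IsContextFree.hasExponentPumping {T : Type*} {L : Language T}
    (hL : L.IsContextFree) : HasExponentPumping (L : Set (List T)) := by
  classical
  obtain ⟨g, rfl⟩ := hL
  intro p a s
  have hfin : {A | ∃ o, g.RuleRel A o}.Finite := by
    refine (g.rules.finite_toSet.image ContextFreeRule.input).subset ?_
    rintro A ⟨o, r, hr, rfl, rfl⟩
    exact ⟨r, hr, rfl⟩
  obtain ⟨Q, hQ, B, h⟩ := exists_pump_replicate hfin
    (m := g.rules.sup fun r => r.output.length) (by
      rintro A o ⟨r, hr, rfl, rfl⟩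
      exact Finset.le_sup (f := fun r => r.output.length) hr) p a s
  refine ⟨Q, hQ, B, fun K hK hw => ?_⟩
  exact (g.mem_language_iff_derivesWord _).2
    (h _ K hK ((g.mem_language_iff_derivesWord _).1 hw))

/-! ### The triple construction, and the passage from final states to empty stack -/

namespace PushdownAutomaton

variable {Q T Γ : Type} (M : PushdownAutomaton Q T Γ)

/-- `PopChain p α q o`: the sentential form `o` consists of the nonterminals `(pᵢ, Xᵢ, pᵢ₊₁)`,
where `α = X₁ X₂ …` and `p = p₁, p₂, …, q` are states. -/
inductive PopChain : Q → List Γ → Q → List (Symbol T (Q × Γ × Q)) → Prop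
  | nil (p : Q) : PopChain p [] p []
  | cons (p r : Q) (X : Γ) {q : Q} {α : List Γ} {o : List (Symbol T (Q × Γ × Q))}
      (h : PopChain r α q o) : PopChain p (X :: α) q (.nonterminal (p, X, r) :: o)

/-- The rules for the nonterminals `(p, X, q)`, which derive the words on which `M` goes from
the state `p` to the state `q` and removes `X` from the stack. -/
def PopRule (A : Q × Γ × Q) (o : List (Symbol T (Q × Γ × Q))) : Prop :=
  ∃ (a : Option T) (p : Q) (α : List Γ) (o' : List (Symbol T (Q × Γ × Q))),
    (p, α) ∈ M.δ A.1 a A.2.1 ∧ PopChain p α A.2.2 o' ∧ o = a.toList.map Symbol.terminal ++ o'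

theorem PopChain.length_eq {p q : Q} {α : List Γ} {o : List (Symbol T (Q × Γ × Q))}
    (h : PopChain p α q o) : o.length = α.length := by
  induction h with
  | nil => rfl
  | cons _ _ _ _ ih => simp [ih]

theorem PopChain.exists_of_append {p q : Q} {α β : List Γ} {o : List (Symbol T (Q × Γ × Q))}
    (h : PopChain p (α ++ β) q o) :
    ∃ r o₁ o₂, o = o₁ ++ o₂ ∧ PopChain p α r o₁ ∧ PopChain r β q o₂ := by
  induction α generalizing p o with
  | nil => exact ⟨p, [], o, rfl, .nil p, h⟩
  | cons X α ih =>
    cases h with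
    | cons _ r' _ h =>
      obtain ⟨r, o₁, o₂, rfl, h₁, h₂⟩ := ih h
      exact ⟨r, _, o₂, rfl, .cons p r' X h₁, h₂⟩

theorem exists_popChain_of_steps {p q : Q} {w : List T} {γ : List Γ}
    (h : Relation.ReflTransGen M.Step (p, w, γ) (q, [], [])) :
    ∃ o, PopChain p γ q o ∧ DerivesWord M.PopRule o w := by
  generalize hc : (p, w, γ) = c at h
  induction h using Relation.ReflTransGen.head_induction_on generalizing p w γ with
  | refl =>
    cases hc
    exact ⟨[], .nil _, .nil⟩
  | head h _ ih =>
    subst hc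
    cases h with
    | @read _ p' a X α w β hδ =>
      obtain ⟨o, ho, hw⟩ := ih rfl
      obtain ⟨r, o₁, o₂, rfl, h₁, h₂⟩ := ho.exists_of_append
      obtain ⟨w₁, w₂, rfl, hw₁, hw₂⟩ := hw.exists_of_append
      exact ⟨_, .cons p r X h₂, DerivesWord.nonterminal (w₁ := a :: w₁)
        ⟨some a, p', α, o₁, hδ, h₁, rfl⟩ (.terminal a hw₁) hw₂⟩
    | @eps _ p' X α w β hδ =>
      obtain ⟨o, ho, hw⟩ := ih rfl
      obtain ⟨r, o₁, o₂, rfl, h₁, h₂⟩ := ho.exists_of_append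
      obtain ⟨w₁, w₂, rfl, hw₁, hw₂⟩ := hw.exists_of_append
      exact ⟨_, .cons p r X h₂, DerivesWord.nonterminal
        ⟨none, p', α, o₁, hδ, h₁, rfl⟩ hw₁ hw₂⟩

/-- The right-hand side of a rule is a chain preceded by at most one terminal. Allowing this
optional letter in the statement lets one induction treat both chains and right-hand sides. -/
theorem steps_of_derivesWord {s : List (Symbol T (Q × Γ × Q))} {w : List T}
    (h : DerivesWord M.PopRule s w) (a : Option T) (o : List (Symbol T (Q × Γ × Q)))
    (hs : s = a.toList.map Symbol.terminal ++ o) (p q : Q) (α : List Γ) (ho : PopChain p α q o) :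
    ∃ w', w = a.toList ++ w' ∧ ∀ v β,
      Relation.ReflTransGen M.Step (p, w' ++ v, α ++ β) (q, v, β) := by
  induction h generalizing a o p q α with
  | nil =>
    cases a with
    | some a => simp at hs
    | none =>
      obtain rfl : o = [] := by simpa using hs.symm
      cases ho
      exact ⟨[], rfl, fun v β => .refl⟩
  | terminal c h ih =>
    cases a with
    | none =>
      obtain rfl : o = _ := by simpa using hs.symm
      cases ho
    | some a =>
      simp only [Option.toList_some, List.map_cons, List.map_nil, List.cons_append,
        List.nil_append, List.cons.injEq, Symbol.terminal.injEq] at hs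
      obtain ⟨rfl, hs⟩ := hs
      obtain ⟨w', hw, h'⟩ := ih none o hs p q α ho
      exact ⟨w', congrArg _ hw, h'⟩
  | @nonterminal A o₁ s w₁ w₂ hR h₁ h₂ ih₁ ih₂ =>
    cases a with
    | some a => simp at hs
    | none =>
      obtain rfl : o = _ := by simpa using hs.symm
      cases ho with
      | cons _ r X ho =>
        obtain ⟨a, p', α', o', hδ, ho', rfl⟩ := hR
        obtain ⟨w₁', rfl, h₁'⟩ := ih₁ a o' rfl p' r α' ho'
        obtain ⟨w₂', hw₂, h₂'⟩ := ih₂ none s rfl r q _ ho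
        obtain rfl : w₂ = w₂' := hw₂
        refine ⟨_, rfl, fun v β => ?_⟩
        have hrest := (h₁' (w₂ ++ v) (_ ++ β)).trans (h₂' v β)
        cases a with
        | none => simpa using hrest.head (Step.eps (w₁' ++ (w₂ ++ v)) _ hδ)
        | some a => simpa using hrest.head (Step.read (w₁' ++ (w₂ ++ v)) _ hδ)

theorem derivesWord_popRule_iff (p q : Q) (X : Γ) (w : List T) :
    DerivesWord M.PopRule [.nonterminal (p, X, q)] w ↔
      Relation.ReflTransGen M.Step (p, w, [X]) (q, [], []) := by
  constructor
  · intro h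
    obtain ⟨w', rfl, h'⟩ := M.steps_of_derivesWord h none _ rfl p q [X] (.cons p q X (.nil q))
    simpa using h' [] []
  · intro h
    obtain ⟨o, ho, hw⟩ := M.exists_popChain_of_steps h
    cases ho with
    | cons _ r _ ho =>
      cases ho
      exact hw

/-- Words on which `M` empties its stack and ends in a given set of states have pumping. -/
theorem hasExponentPumping_emptyStack [Finite Q] [Finite T] [Finite Γ] (F : Set Q) :
    HasExponentPumping
      {w | ∃ q ∈ F, Relation.ReflTransGen M.Step (M.start, w, [M.bottom]) (q, [], [])} := by
  classical
  intro p a s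
  have := Fintype.ofFinite Q
  have := Fintype.ofFinite T
  have := Fintype.ofFinite Γ
  obtain ⟨P, hP, B, h⟩ := exists_pump_replicate (R := M.PopRule) (Set.toFinite _)
    (m := 1 + Finset.univ.sup fun x : Q × Option T × Γ =>
      (M.δ x.1 x.2.1 x.2.2).sup fun y => y.2.length) (by
    rintro ⟨q, X, r⟩ o ⟨a, p, α, o', hδ, ho, rfl⟩
    have h₁ : α.length ≤ (M.δ q a X).sup fun y => y.2.length :=
      Finset.le_sup (f := fun y : Q × List Γ => y.2.length) hδ
    have h₂ := Finset.le_sup (f := fun x : Q × Option T × Γ =>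
      (M.δ x.1 x.2.1 x.2.2).sup fun y => y.2.length) (Finset.mem_univ (q, a, X))
    have h₃ : a.toList.length ≤ 1 := by cases a <;> simp
    simp only [List.length_append, List.length_map, ho.length_eq]
    exact add_le_add h₃ (h₁.trans h₂)) p a s
  refine ⟨P, hP, B, fun K hK => ?_⟩
  rintro ⟨q, hq, hw⟩
  exact ⟨q, hq, (M.derivesWord_popRule_iff _ _ _ _).1
    (h _ K hK ((M.derivesWord_popRule_iff _ _ _ _).2 hw))⟩

open Classical in
/-- The automaton `M` with an additional state, which can be entered from the states in `F` and
in which the stack is emptied. -/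
noncomputable def emptying (F : Set Q) : PushdownAutomaton (Option Q) T Γ where
  start := some M.start
  bottom := M.bottom
  final := ∅
  δ q a X := match q, a with
    | some q, a => (M.δ q a X).image (fun x => (some x.1, x.2)) ∪
        (if q ∈ F ∧ a = none then {(none, [])} else ∅)
    | none, none => {(none, [])}
    | none, some _ => ∅

variable {M} in
theorem Step.emptying {F : Set Q} {q p : Q} {w v : List T} {γ β : List Γ}
    (h : M.Step (q, w, γ) (p, v, β)) : (M.emptying F).Step (some q, w, γ) (some p, v, β) := by
  classical
  cases h with
  | read _ _ h =>
    exact .read _ _ (Finset.mem_union_left _ (Finset.mem_image_of_mem _ h))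
  | eps _ _ h =>
    exact .eps _ _ (Finset.mem_union_left _ (Finset.mem_image_of_mem _ h))

theorem emptying_steps_none (F : Set Q) (γ : List Γ) :
    Relation.ReflTransGen (M.emptying F).Step (none, [], γ) (none, [], []) := by
  induction γ with
  | nil => exact .refl
  | cons X γ ih =>
    refine ih.head (Step.eps (α := []) [] γ ?_)
    simp [emptying]

theorem emptying_steps_of_steps (F : Set Q) {c c' : Q × List T × List Γ}
    (h : Relation.ReflTransGen M.Step c c') :
    Relation.ReflTransGen (M.emptying F).Step (some c.1, c.2) (some c'.1, c'.2) := by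
  induction h with
  | refl => exact .refl
  | tail _ h ih => exact ih.tail h.emptying

/-- Once the additional state is entered, the simulated run of `M` stays frozen in a state of `F`:
later moves remove stack symbols and read no input. -/
theorem steps_of_emptying_steps (F : Set Q) (w : List T) {c : Option Q × List T × List Γ}
    (h : Relation.ReflTransGen (M.emptying F).Step (some M.start, w, [M.bottom]) c) :
    ∃ q γ, Relation.ReflTransGen M.Step (M.start, w, [M.bottom]) (q, c.2.1, γ) ∧
      ((c.1 = some q ∧ γ = c.2.2) ∨ (c.1 = none ∧ q ∈ F)) := by
  classical
  induction h with
  | refl => exact ⟨_, _, .refl, .inl ⟨rfl, rfl⟩⟩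
  | tail _ h ih =>
    obtain ⟨q, γ, hs, hq⟩ := ih
    cases h with
    | @read q₁ p a X α v β hδ =>
      rcases hq with ⟨rfl, rfl⟩ | ⟨rfl, hq⟩
      · simp only [emptying, Finset.mem_union, Finset.mem_image, Prod.mk.injEq] at hδ
        rcases hδ with ⟨x, hx, rfl, rfl⟩ | hδ
        · exact ⟨_, _, hs.tail (.read v β hx), .inl ⟨rfl, rfl⟩⟩
        · simp at hδ
      · simp [emptying] at hδ
    | @eps q₁ p X α v β hδ =>
      rcases hq with ⟨rfl, rfl⟩ | ⟨rfl, hq⟩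
      · simp only [emptying, Finset.mem_union, Finset.mem_image, Prod.mk.injEq] at hδ
        rcases hδ with ⟨x, hx, rfl, rfl⟩ | hδ
        · exact ⟨_, _, hs.tail (.eps v β hx), .inl ⟨rfl, rfl⟩⟩
        · split_ifs at hδ with hF
          · obtain ⟨rfl, rfl⟩ : p = none ∧ α = [] := by simpa using hδ
            exact ⟨q, _, hs, .inr ⟨rfl, hF.1⟩⟩
          · simp at hδ
      · obtain ⟨rfl, rfl⟩ : p = none ∧ α = [] := by simpa [emptying] using hδ
        exact ⟨q, γ, hs, .inr ⟨rfl, hq⟩⟩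

theorem hasExponentPumping_of_final [Finite Q] [Finite T] [Finite Γ] (F : Set Q) :
    HasExponentPumping {w | ∃ q ∈ F, ∃ γ,
      Relation.ReflTransGen M.Step (M.start, w, [M.bottom]) (q, [], γ)} := by
  -- With an empty stack no move is possible, not even into the additional state, so the states of
  -- `F` must accept as well.
  convert (M.emptying F).hasExponentPumping_emptyStack (insert none (some '' F)) using 1
  ext w
  constructor
  · rintro ⟨q, hq, γ, h⟩
    have h' := M.emptying_steps_of_steps F h
    cases γ with
    | nil => exact ⟨some q, .inr ⟨q, hq, rfl⟩, h'⟩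
    | cons X γ =>
      refine ⟨none, .inl rfl, (h'.tail (.eps (p := none) (α := []) [] γ ?_)).trans
        (M.emptying_steps_none F γ)⟩
      simp [emptying, hq]
  · rintro ⟨q', hq', h⟩
    obtain ⟨q, γ, hs, hq⟩ := M.steps_of_emptying_steps F w h
    rcases hq with ⟨rfl, -⟩ | ⟨-, hq⟩
    · simp only [Set.mem_insert_iff, reduceCtorEq, Set.mem_image, Option.some.injEq,
        exists_eq_right, false_or] at hq'
      exact ⟨q, hq', γ, hs⟩
    · exact ⟨q, hq, γ, hs⟩

end PushdownAutomaton

/-- The words on which a function computed by a push-down automaton has a given property have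
pumping. -/
theorem PDAComputable.hasExponentPumping {A O : Type} [Finite A] {f : List A → O}
    (hf : PDAComputable f) (P : O → Prop) : HasExponentPumping {z | P (f z)} := by
  obtain ⟨Q, Γ, _, _, M, out, h⟩ := hf
  intro p a s
  -- All final outcomes on an input carry the same label, so accepting those labelled by `P` decides
  -- `P (f z)` despite nondeterminism.
  have key : ∀ z : List A, P (f z) ↔ z.map some ++ [none] ∈
      {w | ∃ q ∈ {q | q ∈ M.final ∧ P (out q)}, ∃ γ,
        Relation.ReflTransGen M.Step (M.start, w, [M.bottom]) (q, [], γ)} := by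
    intro z
    constructor
    · intro hz
      obtain ⟨q, hq⟩ := (h z).1
      exact ⟨q, ⟨hq.1, by rwa [(h z).2 q hq]⟩, hq.2⟩
    · rintro ⟨q, ⟨hq, hP⟩, hs⟩
      rwa [← (h z).2 q ⟨hq, hs⟩]
  obtain ⟨K, hK, B, hB⟩ := M.hasExponentPumping_of_final {q | q ∈ M.final ∧ P (out q)}
    (p.map some) (some a) (s.map some ++ [none])
  refine ⟨K, hK, B, fun k hk hz => (key _).2 ?_⟩
  have := hB k hk (by simpa using (key _).1 hz)
  simpa using this

/-! ### Multiples of an irrational number modulo one -/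

/-- Finitely many multiples of an irrational number meet every interval of length `ε` modulo
one. -/
theorem Irrational.exists_nat_mul_add_int_mem_Ioo {θ : ℝ} (hθ : Irrational θ) {ε : ℝ}
    (hε : 0 < ε) :
    ∃ M : ℕ, ∀ x : ℝ, ∃ k ≤ M, ∃ j : ℤ, (k : ℝ) * θ + j ∈ Set.Ioo x (x + ε) := by
  obtain ⟨m, hm⟩ := exists_nat_gt (1 / ε)
  have hm0 : 0 < m := by
    have : (0 : ℝ) < m := lt_trans (by positivity) hm
    exact_mod_cast this
  obtain ⟨q, hq0, -, hq⟩ := Real.exists_nat_abs_mul_sub_round_le θ hm0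
  set δ := (q : ℝ) * θ - round ((q : ℝ) * θ) with hδ
  have hδε : |δ| < ε := by
    refine hq.trans_lt ?_
    rw [div_lt_comm₀ (by positivity) hε]
    linarith
  have hδ0 : δ ≠ 0 := ((hθ.natCast_mul hq0.ne').sub_intCast _).ne_zero
  have hpos : 0 < |δ| := abs_pos.2 hδ0
  -- Steps of length `|δ| < ε` cannot jump over the interval, and this many of them pass once around
  -- the circle.
  refine ⟨(⌊1 / |δ|⌋₊ + 1) * q, fun x => ?_⟩
  have step : ∀ y : ℝ, 0 ≤ y → y < 1 → ∃ i ≤ ⌊1 / |δ|⌋₊ + 1, y < i * |δ| ∧ i * |δ| ≤ y + |δ| := by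
    intro y hy hy1
    refine ⟨⌊y / |δ|⌋₊ + 1, ?_, ?_, ?_⟩
    · gcongr
    · push_cast
      exact (div_lt_iff₀ hpos).1 (Nat.lt_floor_add_one _)
    · push_cast
      have := (le_div_iff₀ hpos).1 (Nat.floor_le (div_nonneg hy hpos.le))
      linarith
  rcases lt_or_gt_of_ne hδ0 with hneg | hδpos
  · obtain ⟨i, hi, h₁, h₂⟩ := step (Int.fract (-(x + ε))) (Int.fract_nonneg _) (Int.fract_lt_one _)
    refine ⟨i * q, Nat.mul_le_mul_right q hi,
      -⌊-(x + ε)⌋ - i * round ((q : ℝ) * θ), ?_⟩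
    have hf := Int.fract_add_floor (-(x + ε))
    have he : ((i * q : ℕ) : ℝ) * θ + ((-⌊-(x + ε)⌋ - i * round ((q : ℝ) * θ) : ℤ) : ℝ) =
        i * δ - ⌊-(x + ε)⌋ := by
      rw [hδ]; push_cast; ring
    rw [he]
    rw [abs_of_neg hneg] at h₁ h₂ hδε
    constructor <;> linarith
  · obtain ⟨i, hi, h₁, h₂⟩ := step (Int.fract x) (Int.fract_nonneg _) (Int.fract_lt_one _)
    refine ⟨i * q, Nat.mul_le_mul_right q hi, ⌊x⌋ - i * round ((q : ℝ) * θ), ?_⟩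
    have hf := Int.fract_add_floor x
    have he : ((i * q : ℕ) : ℝ) * θ + ((⌊x⌋ - i * round ((q : ℝ) * θ) : ℤ) : ℝ) =
        i * δ + ⌊x⌋ := by
      rw [hδ]; push_cast; ring
    rw [he]
    rw [abs_of_pos hδpos] at h₁ h₂ hδε
    constructor <;> linarith

/-- The numbers `bᴷ φ` with `φ` irrational do not converge to zero modulo one. -/
theorem Irrational.exists_le_abs_pow_mul_sub_round {φ : ℝ} (hφ : Irrational φ) {b : ℕ}
    (hb : 2 ≤ b) (N : ℕ) :
    ∃ K ≥ N, 1 / (2 * (b : ℝ)) ≤ |(b : ℝ) ^ K * φ - round ((b : ℝ) ^ K * φ)| := by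
  by_contra! hcon
  have hb2 : (2 : ℝ) ≤ b := by exact_mod_cast hb
  have hb0 : (0 : ℝ) < b := by linarith
  set δ : ℕ → ℝ := fun K => (b : ℝ) ^ K * φ - round ((b : ℝ) ^ K * φ) with hδ
  -- Below 1/(2b), multiplication by `b` stays within 1/2 of the same integer, so the signed
  -- distance is multiplied exactly.
  have hstep : ∀ K ≥ N, |δ (K + 1)| = b * |δ K| := by
    intro K hK
    have h1 := hcon K hK
    have h2 : |(b : ℝ) * δ K| < 1 / 2 := by
      rw [abs_mul, abs_of_pos hb0]
      rw [lt_div_iff₀ (by positivity)] at h1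
      simp only [hδ]
      linarith
    have h3 : round ((b : ℝ) * δ K) = 0 := by
      rw [round_eq_zero_iff]
      rw [abs_lt] at h2
      constructor <;> linarith
    have h4 : (b : ℝ) ^ (K + 1) * φ = b * δ K + ((b * round ((b : ℝ) ^ K * φ) : ℤ) : ℝ) := by
      simp only [hδ]; push_cast; ring
    have h5 : δ (K + 1) = b * δ K := by
      change (b : ℝ) ^ (K + 1) * φ - round ((b : ℝ) ^ (K + 1) * φ) = _
      rw [h4, round_add_intCast, h3]
      push_cast
      ring
    rw [h5, abs_mul, abs_of_pos hb0]
  have hpow : ∀ i, |δ (N + i)| = (b : ℝ) ^ i * |δ N| := by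
    intro i
    induction i with
    | zero => simp
    | succ i ih => rw [← add_assoc, hstep _ (by omega), ih]; ring
  have hpos : 0 < |δ N| := by
    have h1 : Irrational ((b : ℝ) ^ N * φ) := by
      have := hφ.natCast_mul (m := b ^ N) (by positivity)
      simpa using this
    exact abs_pos.2 (h1.sub_intCast _).ne_zero
  obtain ⟨i, hi⟩ := pow_unbounded_of_one_lt (1 / |δ N|) (by linarith : (1 : ℝ) < b)
  have h1 := hcon (N + i) (by omega)
  rw [div_lt_iff₀ hpos] at hi
  have h2 : |δ (N + i)| < 1 / (2 * (b : ℝ)) := h1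
  rw [hpow i] at h2
  have h3 : 1 / (2 * (b : ℝ)) ≤ 1 := by
    rw [div_le_one (by positivity)]; linarith
  linarith

/-- A predicate on the natural numbers that is preserved by a shift is eventually invariant under
all multiples of that shift. -/
theorem exists_iff_of_shift {P : ℕ → Prop} {Q N : ℕ} (hQ : 0 < Q)
    (h : ∀ K ≥ N, P K → P (K + Q)) :
    ∃ N', ∀ K ≥ N', ∀ i, P K ↔ P (K + i * Q) := by
  have hmul : ∀ i, ∀ K ≥ N, P K → P (K + i * Q) := by
    intro i
    induction i with
    | zero => intro K _ hP; simpa using hP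
    | succ i ih =>
      intro K hK hP
      have := h _ (by omega) (ih K hK hP)
      rwa [show K + (i + 1) * Q = K + i * Q + Q by ring]
  have hex : ∀ r : ℕ, ∃ n, ∀ K ≥ n, K % Q = r → ∀ i, P (K + i * Q) → P K := by
    intro r
    -- Within a residue class modulo `Q` the predicate either fails from `N` on or, once true,
    -- remains true.
    by_cases hr : ∃ K ≥ N, K % Q = r ∧ P K
    · obtain ⟨K₀, h₁, h₂, h₃⟩ := hr
      refine ⟨K₀, fun K hK hKr i _ => ?_⟩
      obtain ⟨c, hc⟩ := (Nat.modEq_iff_dvd' hK).1 (h₂.trans hKr.symm)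
      have := hmul c K₀ h₁ h₃
      rwa [mul_comm, ← hc, Nat.add_sub_cancel' hK] at this
    · refine ⟨N, fun K hK hKr i hi => (hr ⟨K + i * Q, by omega, ?_, hi⟩).elim⟩
      rw [Nat.add_mul_mod_self_right, hKr]
  choose n hn using hex
  refine ⟨N + ∑ r ∈ Finset.range Q, n r, fun K hK i => ⟨hmul i K (by omega), ?_⟩⟩
  refine hn (K % Q) K (le_trans ?_ hK) rfl i
  have := Finset.single_le_sum (f := n) (fun _ _ => Nat.zero_le _)
    (Finset.mem_range.2 (Nat.mod_lt K hQ))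
  omega

/-- If finitely many shifts of a set separate the points `bᴷ θ` modulo one, the codings of these
points by the shifts cannot all be eventually periodic: the case of an arc of length at most one
half. -/
theorem false_of_shift_iff_of_le_half {θ : ℝ} (hθ : Irrational θ) {b : ℕ} (hb : 2 ≤ b)
    {β β' : ℝ} (h₁ : β < β') (h₂ : β' ≤ β + 1 / 2) {P : ℕ → ℕ → Prop}
    (hin : ∀ k, ∃ N, ∀ K ≥ N, ∀ j : ℤ,
      ((k + b ^ K : ℕ) : ℝ) * θ + j ∈ Set.Ioo β β' → P k K)
    (hout : ∀ k, ∃ N, ∀ K ≥ N, ∀ j : ℤ,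
      ((k + b ^ K : ℕ) : ℝ) * θ + j ∈ Set.Ioo β' (β + 1) → ¬ P k K)
    (hper : ∀ k, ∃ Q > 0, ∃ N, ∀ K ≥ N, ∀ i, P k K ↔ P k (K + i * Q)) : False := by
  have hb2 : (2 : ℝ) ≤ b := by exact_mod_cast hb
  set η : ℝ := 1 / (2 * (b : ℝ)) with hη
  have hη0 : 0 < η := by positivity
  set ε := min η (β' - β) with hε
  have hε0 : 0 < ε := lt_min hη0 (by linarith)
  have hεη : ε ≤ η := min_le_left _ _
  have hεβ : ε ≤ β' - β := min_le_right _ _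
  obtain ⟨M, hM⟩ := hθ.exists_nat_mul_add_int_mem_Ioo hε0
  choose N₁ hin using hin
  choose N₂ hout using hout
  choose Q hQ N₃ hper using hper
  set R := ∏ k ∈ Finset.range (M + 1), Q k with hR
  have hR0 : 0 < R := Finset.prod_pos fun k _ => hQ k
  set N := ∑ k ∈ Finset.range (M + 1), (N₁ k + N₂ k + N₃ k) with hN
  have hNk : ∀ k ≤ M, N₁ k + N₂ k + N₃ k ≤ N := fun k hk =>
    Finset.single_le_sum (f := fun k => N₁ k + N₂ k + N₃ k) (fun _ _ => Nat.zero_le _)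
      (Finset.mem_range.2 (by omega))
  have hiff : ∀ k ≤ M, ∀ K ≥ N, P k K ↔ P k (K + R) := by
    intro k hk K hK
    obtain ⟨c, hc⟩ := Finset.dvd_prod_of_mem Q (Finset.mem_range.2 (by omega : k < M + 1))
    have := hper k K (by have := hNk k hk; omega) c
    rwa [mul_comm, ← hc] at this
  -- two points whose distance lies between `η` and one half are separated
  have sep : ∀ (K K' : ℕ), K ≥ N → K' ≥ N → (∀ k ≤ M, P k K ↔ P k K') → ∀ (t : ℝ) (i : ℤ),
      (b : ℝ) ^ K' * θ = (b : ℝ) ^ K * θ + t + i → η ≤ t → t ≤ 1 / 2 → False := by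
    intro K K' hK hK' hPK t i he ht₁ ht₂
    -- The shift puts the first point within `ε` below the endpoint `β'`. Since `ε ≤ η ≤ t ≤ 1/2`
    -- and `β' + 1/2 ≤ β + 1`, the second point falls in the complementary arc.
    obtain ⟨k, hk, j, hj⟩ := hM (β' - ε - (b : ℝ) ^ K * θ)
    have hk' := hNk k hk
    refine hout k K' (by omega) (j - i) ?_ ((hPK k hk).1 (hin k K (by omega) j ?_))
    · push_cast
      constructor <;> linarith [hj.1, hj.2, add_mul (k : ℝ) ((b : ℝ) ^ K') θ]
    · push_cast
      constructor <;> linarith [hj.1, hj.2, add_mul (k : ℝ) ((b : ℝ) ^ K) θ]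
  have hirr : Irrational (((b : ℝ) ^ R - 1) * θ) := by
    have h1 : 1 < b ^ R := Nat.one_lt_pow hR0.ne' (by omega)
    have := hθ.natCast_mul (m := b ^ R - 1) (by omega)
    rw [Nat.cast_sub h1.le] at this
    simpa using this
  obtain ⟨K, hK, hfar⟩ := hirr.exists_le_abs_pow_mul_sub_round hb N
  set t := (b : ℝ) ^ K * (((b : ℝ) ^ R - 1) * θ) - round ((b : ℝ) ^ K * (((b : ℝ) ^ R - 1) * θ))
    with ht
  have ht2 : |t| ≤ 1 / 2 := abs_sub_round _
  have he : (b : ℝ) ^ (K + R) * θ =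
      (b : ℝ) ^ K * θ + t + round ((b : ℝ) ^ K * (((b : ℝ) ^ R - 1) * θ)) := by
    rw [ht, pow_add]; ring
  rcases le_total 0 t with h0 | h0
  · rw [abs_of_nonneg h0] at hfar ht2
    exact sep K (K + R) hK (by omega) (fun k hk => hiff k hk K hK) t _ he hfar ht2
  · rw [abs_of_nonpos h0] at hfar ht2
    refine sep (K + R) K (by omega) hK (fun k hk => (hiff k hk K hK).symm) (-t)
      (-round ((b : ℝ) ^ K * (((b : ℝ) ^ R - 1) * θ))) ?_ hfar ht2
    rw [he]; push_cast; ring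

/-- Let `P k K` hold if `(k + bᴷ) θ` lies in a proper arc modulo one, and fail if it lies in the
complementary arc. Then `P k` cannot be preserved by shifts of large arguments for all `k`. -/
theorem false_of_shift {θ : ℝ} (hθ : Irrational θ) {b : ℕ} (hb : 2 ≤ b)
    {β β' : ℝ} (h₁ : β < β') (h₂ : β' < β + 1) {P : ℕ → ℕ → Prop}
    (hin : ∀ k, ∃ N, ∀ K ≥ N, ∀ j : ℤ,
      ((k + b ^ K : ℕ) : ℝ) * θ + j ∈ Set.Ioo β β' → P k K)
    (hout : ∀ k, ∃ N, ∀ K ≥ N, ∀ j : ℤ,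
      ((k + b ^ K : ℕ) : ℝ) * θ + j ∈ Set.Ioo β' (β + 1) → ¬ P k K)
    (hshift : ∀ k, ∃ Q > 0, ∃ N, ∀ K ≥ N, P k K → P k (K + Q)) : False := by
  have hper : ∀ k, ∃ Q > 0, ∃ N, ∀ K ≥ N, ∀ i, P k K ↔ P k (K + i * Q) := by
    intro k
    obtain ⟨Q, hQ, N, h⟩ := hshift k
    exact ⟨Q, hQ, exists_iff_of_shift hQ h⟩
  rcases le_total β' (β + 1 / 2) with h | h
  · exact false_of_shift_iff_of_le_half hθ hb h₁ h hin hout hper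
  -- For a long arc, complement: the other arc is short, and the two-sided periodicity passes to the
  -- negation.
  · refine false_of_shift_iff_of_le_half hθ hb (P := fun k K => ¬ P k K) h₂ (by linarith) hout
      (fun k => ?_) (fun k => ?_)
    · obtain ⟨N, hN⟩ := hin k
      refine ⟨N, fun K hK j hj => not_not.2 (hN K hK (j - 1) ?_)⟩
      push_cast at hj ⊢
      constructor <;> linarith [hj.1, hj.2]
    · obtain ⟨Q, hQ, N, h⟩ := hper k
      exact ⟨Q, hQ, N, fun K hK i => not_congr (h K hK i)⟩

/-! ### Significands and arcs of the circle -/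

/-- For `d = 2` the leading digit is always 1, so the second digit must split the range. The
excluded case `d = 2`, `n = 1` has only one significand. -/
theorem exists_leadsWith_iff_lt {d n : ℕ} (hd : 2 ≤ d) (hdn : 2 < d ∨ 1 < n) :
    ∃ c < d, ∃ B, d ^ (n - 1) < B ∧ B < d * d ^ (n - 1) ∧
      ∀ m, d ^ (n - 1) ≤ m → (LeadsWith d n m c ↔ m < B) := by
  by_cases h2 : d = 2
  · subst h2
    obtain ⟨k, rfl⟩ : ∃ k, n = k + 2 := ⟨n - 2, by omega⟩
    have hk : 0 < 2 ^ k := by positivity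
    have hpow : 2 ^ (k + 2 - 1) = 2 * 2 ^ k := by
      rw [show k + 2 - 1 = k + 1 by omega, pow_succ]; ring
    refine ⟨0, by omega, 3 * 2 ^ k, by omega, by omega, fun m hm => ?_⟩
    rw [hpow] at hm
    rw [LeadsWith, if_pos rfl, Nat.add_sub_cancel, Nat.div_eq_iff hk]
    omega
  · have hP : 0 < d ^ (n - 1) := by positivity
    refine ⟨1, by omega, 2 * d ^ (n - 1), by omega,
      Nat.mul_lt_mul_of_pos_right (by omega) hP, fun m hm => ?_⟩
    rw [LeadsWith, if_neg h2, Nat.div_eq_iff hP]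
    omega

section Arcs

variable {d n B m : ℕ} {r : ℝ}

theorem sub_inv_pos (hd : 2 ≤ d) : 0 < ((d ^ (n - 1) : ℕ) : ℝ) - 1 / (2 * d) := by
  have hd2 : (2 : ℝ) ≤ d := by exact_mod_cast hd
  have h1 : (1 : ℝ) ≤ (d ^ (n - 1) : ℕ) := by exact_mod_cast Nat.one_le_pow _ _ (by omega)
  have h2 : 1 / (2 * (d : ℝ)) < 1 := by rw [div_lt_one (by positivity)]; linarith
  linarith

/-- The bound -1/(2d) at `m = d^(n-1)` is the tie at d^n - 1/2 divided by `d`; this is why the two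
arcs close up to a full circle. -/
theorem logb_sub_inv_add_one (hd : 2 ≤ d) :
    Real.logb d (((d ^ (n - 1) : ℕ) : ℝ) - 1 / (2 * d)) + 1 =
      Real.logb d (((d * d ^ (n - 1) : ℕ) : ℝ) - 1 / 2) := by
  have hd1 : (1 : ℝ) < d := by exact_mod_cast hd
  have hd0 : (0 : ℝ) < d := by linarith
  have he : (((d * d ^ (n - 1) : ℕ) : ℝ) - 1 / 2) =
      (((d ^ (n - 1) : ℕ) : ℝ) - 1 / (2 * d)) * d := by
    push_cast; field_simp
  rw [he, Real.logb_mul (sub_inv_pos hd).ne' hd0.ne', Real.logb_self_eq_one hd1]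

theorem logb_sub_inv_lt (hd : 2 ≤ d) (hB : d ^ (n - 1) < B) :
    Real.logb d (((d ^ (n - 1) : ℕ) : ℝ) - 1 / (2 * d)) < Real.logb d ((B : ℝ) - 1 / 2) := by
  have hd1 : (1 : ℝ) < d := by exact_mod_cast hd
  have h : ((d ^ (n - 1) : ℕ) : ℝ) + 1 ≤ B := by exact_mod_cast hB
  have h2 : 0 < 1 / (2 * (d : ℝ)) := by positivity
  exact Real.logb_lt_logb hd1 (sub_inv_pos hd) (by linarith)

theorem logb_sub_half_lt (hd : 2 ≤ d) (hB : d ^ (n - 1) < B) (hB' : B < d * d ^ (n - 1)) :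
    Real.logb d ((B : ℝ) - 1 / 2) <
      Real.logb d (((d ^ (n - 1) : ℕ) : ℝ) - 1 / (2 * d)) + 1 := by
  have hd1 : (1 : ℝ) < d := by exact_mod_cast hd
  rw [logb_sub_inv_add_one hd]
  have h : (B : ℝ) < (d * d ^ (n - 1) : ℕ) := by exact_mod_cast hB'
  have h1 : (1 : ℝ) ≤ B := by exact_mod_cast (Nat.zero_le _).trans_lt hB
  exact Real.logb_lt_logb hd1 (by linarith) (by linarith)

/-- The logarithm of a number with best significand `m` lies, modulo one, in one of two closed
arcs, according to whether `m < B`. -/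
theorem IsBestSignificand.exists_logb_mem (hd : 2 ≤ d) (hn : 1 ≤ n) (hB : d ^ (n - 1) < B)
    (h : IsBestSignificand d n r m) :
    ∃ (y : ℝ) (q : ℤ), Real.logb d r = y + q ∧
      (m < B → y ∈ Set.Icc (Real.logb d (((d ^ (n - 1) : ℕ) : ℝ) - 1 / (2 * d)))
        (Real.logb d ((B : ℝ) - 1 / 2))) ∧
      (¬ m < B → y ∈ Set.Icc (Real.logb d ((B : ℝ) - 1 / 2))
        (Real.logb d (((d ^ (n - 1) : ℕ) : ℝ) - 1 / (2 * d)) + 1)) := by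
  obtain ⟨hm₁, hm₂, q, ε, rfl, hε, hm₃⟩ := h
  have hd1 : (1 : ℝ) < d := by exact_mod_cast hd
  have hd0 : (0 : ℝ) < d := by linarith
  have hd2 : 0 < 1 / (2 * (d : ℝ)) := by positivity
  rw [abs_le] at hε
  have hlow : ((d ^ (n - 1) : ℕ) : ℝ) - 1 / (2 * d) ≤ m + ε := by
    rcases hm₁.eq_or_lt with he | hlt
    · have := hm₃ he.symm
      rw [neg_div] at this
      rw [← he]
      linarith
    · have : ((d ^ (n - 1) : ℕ) : ℝ) + 1 ≤ m := by exact_mod_cast hlt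
      linarith
  have hpos : 0 < (m : ℝ) + ε := (sub_inv_pos hd).trans_le hlow
  refine ⟨Real.logb d (m + ε), q, ?_, fun hmB => ⟨?_, ?_⟩, fun hmB => ⟨?_, ?_⟩⟩
  · rw [Real.logb_mul hpos.ne' (by positivity), ← Real.rpow_intCast,
      Real.logb_rpow hd0 hd1.ne']
  · exact Real.logb_le_logb_of_le hd1 (sub_inv_pos hd) hlow
  · have : (m : ℝ) + 1 ≤ B := by exact_mod_cast hmB
    exact Real.logb_le_logb_of_le hd1 hpos (by linarith)
  · have h1 : (B : ℝ) ≤ m := by exact_mod_cast not_lt.1 hmB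
    have h2 : (1 : ℝ) ≤ B := by exact_mod_cast (Nat.zero_le _).trans_lt hB
    exact Real.logb_le_logb_of_le hd1 (by linarith) (by linarith)
  · rw [logb_sub_inv_add_one hd]
    have h1 : m + 1 ≤ d * d ^ (n - 1) := by
      rw [← pow_succ', Nat.sub_add_cancel hn]; exact hm₂
    have h2 : (m : ℝ) + 1 ≤ (d * d ^ (n - 1) : ℕ) := by exact_mod_cast h1
    exact Real.logb_le_logb_of_le hd1 hpos (by linarith)

/-- Two points, one in an open arc and the other in the complementary closed arc, do not agree
modulo one. -/
theorem add_intCast_notMem_Ioo {β β' y : ℝ} (hy : y ∈ Set.Icc β' (β + 1)) (i : ℤ) :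
    y + i ∉ Set.Ioo β β' := by
  rintro ⟨h₁, h₂⟩
  have hi₁ : (-1 : ℝ) < i := by linarith [hy.2]
  have hi₂ : (i : ℝ) < 0 := by linarith [hy.1]
  have h₁' : (-1 : ℤ) < i := by exact_mod_cast hi₁
  have h₂' : i < 0 := by exact_mod_cast hi₂
  omega

theorem IsBestSignificand.lt_of_logb_mem (hd : 2 ≤ d) (hn : 1 ≤ n) (hB : d ^ (n - 1) < B)
    (h : IsBestSignificand d n r m) (j : ℤ)
    (hj : Real.logb d r + j ∈ Set.Ioo (Real.logb d (((d ^ (n - 1) : ℕ) : ℝ) - 1 / (2 * d)))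
      (Real.logb d ((B : ℝ) - 1 / 2))) : m < B := by
  by_contra hmB
  obtain ⟨y, q, hy, -, hy'⟩ := h.exists_logb_mem hd hn hB
  refine add_intCast_notMem_Ioo (hy' hmB) (q + j) ?_
  rw [hy] at hj
  rwa [Int.cast_add, ← add_assoc]

theorem IsBestSignificand.not_lt_of_logb_mem (hd : 2 ≤ d) (hn : 1 ≤ n) (hB : d ^ (n - 1) < B)
    (h : IsBestSignificand d n r m) (j : ℤ)
    (hj : Real.logb d r + j ∈ Set.Ioo (Real.logb d ((B : ℝ) - 1 / 2))
      (Real.logb d (((d ^ (n - 1) : ℕ) : ℝ) - 1 / (2 * d)) + 1)) : ¬ m < B := by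
  intro hmB
  obtain ⟨y, q, hy, hy', -⟩ := h.exists_logb_mem hd hn hB
  have hy1 := hy' hmB
  have hy2 : y + 1 ∈ Set.Icc (Real.logb d (((d ^ (n - 1) : ℕ) : ℝ) - 1 / (2 * d)) + 1)
      (Real.logb d ((B : ℝ) - 1 / 2) + 1) := ⟨by linarith [hy1.1], by linarith [hy1.2]⟩
  refine add_intCast_notMem_Ioo hy2 (q + j - 1) ?_
  rw [hy] at hj
  rwa [Int.cast_sub, Int.cast_add, Int.cast_one, show y + 1 + ((q : ℝ) + j - 1) = y + q + j by ring]

end Arcs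

/-! ### Numerals -/

theorem exists_valueLSD_eq {b : ℕ} (hb : 2 ≤ b) (k : ℕ) : ∃ u, valueLSD b u = k := by
  induction k using Nat.strong_induction_on with
  | _ k ih =>
    rcases Nat.eq_zero_or_pos k with rfl | hk
    · exact ⟨[], rfl⟩
    · obtain ⟨u, hu⟩ := ih (k / b) (Nat.div_lt_self hk hb)
      refine ⟨⟨k % b, Nat.mod_lt _ (by omega)⟩ :: u, ?_⟩
      rw [valueLSD] at hu ⊢
      rw [List.map_cons, Nat.ofDigits_cons, hu]
      exact Nat.mod_add_div k b

theorem valueLSD_append_replicate {b : ℕ} (hb : 2 ≤ b) (u : List (Fin b)) (K : ℕ) :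
    valueLSD b (u ++ List.replicate K ⟨0, by omega⟩ ++ [⟨1, hb⟩]) =
      valueLSD b u + b ^ (u.length + K) := by
  simp [valueLSD, Nat.ofDigits_append, Nat.ofDigits_replicate_zero, pow_add]

theorem valueMSD_reverse (b : ℕ) (z : List (Fin b)) : valueMSD b z.reverse = valueLSD b z := by
  rw [valueMSD, valueLSD, List.reverse_reverse]

theorem HasExponentPumping.preimage_reverse {T : Type*} {L : Set (List T)}
    (h : HasExponentPumping L) : HasExponentPumping {z | z.reverse ∈ L} := by
  intro p a s
  obtain ⟨Q, hQ, B, hB⟩ := h s.reverse a p.reverse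
  exact ⟨Q, hQ, B, fun K hK hz => by simpa using hB K hK (by simpa using hz)⟩

/-- The words for which the significand of `Dᵉ` is below a proper threshold do not have
pumping. -/
theorem not_hasExponentPumping_lt {b d D n B : ℕ} (hb : 2 ≤ b) (hd : 2 ≤ d)
    (hn : 1 ≤ n) (hirr : Irrational (Real.logb d D)) (hB : d ^ (n - 1) < B)
    (hB' : B < d * d ^ (n - 1)) {f : List (Fin b) → ℕ}
    (hf : ∀ z, IsBestSignificand d n ((D : ℝ) ^ valueLSD b z) (f z)) :
    ¬ HasExponentPumping {z | f z < B} := by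
  intro hpump
  choose u hu using exists_valueLSD_eq hb
  -- The zeros are counted so that the final 1 has weight bᴷ; the truncated subtraction matters only
  -- for small `K`.
  let word (k K : ℕ) : List (Fin b) :=
    u k ++ List.replicate (K - (u k).length) ⟨0, by omega⟩ ++ [⟨1, hb⟩]
  have hlog : ∀ k, ∀ K ≥ (u k).length, Real.logb d ((D : ℝ) ^ valueLSD b (word k K)) =
      ((k + b ^ K : ℕ) : ℝ) * Real.logb d D := by
    intro k K hK
    rw [Real.logb_pow, valueLSD_append_replicate hb, hu, Nat.add_sub_cancel' hK]
  refine false_of_shift hirr hb (logb_sub_inv_lt hd hB) (logb_sub_half_lt hd hB hB')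
    (P := fun k K => f (word k K) < B) (fun k => ⟨(u k).length, fun K hK j hj => ?_⟩)
    (fun k => ⟨(u k).length, fun K hK j hj => ?_⟩) (fun k => ?_)
  · rw [← hlog k K hK] at hj
    exact (hf _).lt_of_logb_mem hd hn hB j hj
  · rw [← hlog k K hK] at hj
    exact (hf _).not_lt_of_logb_mem hd hn hB j hj
  · obtain ⟨Q, hQ, N, h⟩ := hpump (u k) ⟨0, by omega⟩ [⟨1, hb⟩]
    refine ⟨Q, hQ, N + (u k).length + 1, fun K hK hz => ?_⟩
    have := h (K - (u k).length) (by omega) hz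
    rwa [← Nat.sub_add_comm (by omega)] at this

/-- The pattern p aᴷ s is symmetric under reversal, so the reading order is immaterial. -/
theorem not_hasExponentPumping_lt_of_valueMSD {b d D n B : ℕ} (hb : 2 ≤ b) (hd : 2 ≤ d)
    (hn : 1 ≤ n) (hirr : Irrational (Real.logb d D)) (hB : d ^ (n - 1) < B)
    (hB' : B < d * d ^ (n - 1)) {f : List (Fin b) → ℕ}
    (hf : ∀ z, IsBestSignificand d n ((D : ℝ) ^ valueMSD b z) (f z)) :
    ¬ HasExponentPumping {z | f z < B} := fun h =>
  not_hasExponentPumping_lt hb hd hn hirr hB hB' (f := fun z => f z.reverse)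
    (fun z => by simpa only [valueMSD_reverse] using hf z.reverse) h.preimage_reverse

theorem mainTheorem1 (b d D n : ℕ) (hb : 2 ≤ b) (hd : 2 ≤ d) (hD : 2 ≤ D) (hn : 1 ≤ n)
    (hirr : Irrational (Real.logb d D)) (hdn : 2 < d ∨ 1 < n) :
    (∀ s : ℕ → ℕ, IsSignificandSeq d n D s →
      ∃ c₁ < d, ∃ c₂ < d,
        ¬ (langL b d n s c₁).IsContextFree ∧ ¬ (langM b d n s c₂).IsContextFree) ∧
    (¬ ∃ f : List (Fin b) → ℕ, PDAComputable f ∧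
      ∀ z, IsBestSignificand d n ((D : ℝ) ^ valueLSD b z) (f z)) ∧
    (¬ ∃ f : List (Fin b) → ℕ, PDAComputable f ∧
      ∀ z, IsBestSignificand d n ((D : ℝ) ^ valueMSD b z) (f z)) := by
  obtain ⟨c, hc, B, hB, hB', hlead⟩ := exists_leadsWith_iff_lt hd hdn
  refine ⟨fun s hs => ⟨c, hc, c, hc, fun h => ?_, fun h => ?_⟩, ?_, ?_⟩
  · refine not_hasExponentPumping_lt hb hd hn hirr hB hB' (f := fun z => s (valueLSD b z))
      (fun z => hs _) ?_
    have he : {z | s (valueLSD b z) < B} = langL b d n s c :=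
      Set.ext fun z => (hlead _ (hs (valueLSD b z)).1).symm
    rw [he]
    exact h.hasExponentPumping
  · refine not_hasExponentPumping_lt_of_valueMSD hb hd hn hirr hB hB'
      (f := fun z => s (valueMSD b z)) (fun z => hs _) ?_
    have he : {z | s (valueMSD b z) < B} = langM b d n s c :=
      Set.ext fun z => (hlead _ (hs (valueMSD b z)).1).symm
    rw [he]
    exact h.hasExponentPumping
  · rintro ⟨f, hf, hbest⟩
    exact not_hasExponentPumping_lt hb hd hn hirr hB hB' hbest
      (hf.hasExponentPumping fun m => m < B)
  · rintro ⟨f, hf, hbest⟩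
    exact not_hasExponentPumping_lt_of_valueMSD hb hd hn hirr hB hB' hbest
      (hf.hasExponentPumping fun m => m < B)
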